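/- Let $H_0=\sqrt{-\Delta}$ in $L^2(\mathbb R^3)$, i.e. $\varphi(H_0)=\mathcal F^{-1}\varphi(|k|)\mathcal F$ with $\mathcal F$ the unitary Fourier transform, and let $\langle u,v\rangle=\int_{\mathbb R^3}u\,\overline v\,dx$. For $w\in\mathbb C$ and $r\ge 0$ put $$P_w(r)=\frac{w}{\pi^2\,(r^2+w^2)^2}.$$ **Lemma (free evolution formula).** Let $f\in C_c^\infty(\mathbb R^3)$ and let $g\in\mathcal S(\mathbb R^3)$ with $\hat g\in C_c^\infty(\mathbb R^3)$. Then: 1. For every $w$ with $\operatorname{Re}w>0$, both integrals in $$\Phi(w)=\int_{\mathbb R^3}\Big\{\int_{\mathbb R^3}P_w(|x-y|)\,f(y)\,dy\Big\}\,\overline{g(x)}\,dx$$ converge absolutely. One has $\Phi(\tau)=\langle e^{-\tau H_0}f,g\rangle$ for all $\tau>0$, and $\Phi$ is holomorphic on $\{\operatorname{Re}w>0\}$. Moreover, for all real $t,\varepsilon,r$ (with the convention $a/0=0$ where the denominators vanish), $$P_{it+\varepsilon}(r)=\frac{it+\varepsilon}{\pi^2(r+t-i\varepsilon)^2(r-t+i\varepsilon)^2}.$$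 2. For $\pm t>0$, $$\langle e^{-itH_0}f,g\rangle=\lim_{\varepsilon\searrow0}\int_{\mathbb R^3}\Big\{\int_{\mathbb R^3}\frac{it+\varepsilon}{\pi^2\,(|x-y|\pm t\mp i\varepsilon)^2\,(|x-y|\mp t\pm i\varepsilon)^2}\,f(y)\,dy\Big\}\,\overline{g(x)}\,dx .$$ Formally, the pairing $\langle e^{-itH_0}f,g\rangle$ is given by the kernel $$\frac{it}{\pi^2(|x-y|\pm t)^2(|x-y|\mp t\pm i0)^2},$$ the precise meaning being the limit in 2. -/

import Mathlib

open MeasureTheory Filter Topology Complex FourierTransform SchwartzMap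
open scoped ContDiff ComplexConjugate

noncomputable section

/-- Three-dimensional Euclidean space. -/
abbrev R3 : Type := EuclideanSpace ℝ (Fin 3)

/-- The Hilbert space `L²(ℝ³)` of complex-valued functions. -/
abbrev L2R3 : Type := Lp ℂ 2 (volume : Measure R3)

/-- The unitary Fourier transform of `L²(ℝ³)`, with character `e^{-2πi x·ξ}`. -/
def fourierL2 : L2R3 ≃ₗᵢ[ℂ] L2R3 := Lp.fourierTransformₗᵢ R3 ℂ

/-- The symbol `φ(|k|)` times the Fourier transform of `u`, where `k = 2πξ` is the momentum for the
character `e^{-2πi x·ξ}`. -/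
def symbolMul (φ : ℝ → ℂ) (u : L2R3) (ξ : R3) : ℂ :=
  φ (2 * Real.pi * ‖ξ‖) * fourierL2 u ξ

theorem symbolMul_add (φ : ℝ → ℂ) (u v : L2R3) :
    symbolMul φ u + symbolMul φ v =ᵐ[volume] symbolMul φ (u + v) := by
  have h1 : fourierL2 (u + v) = fourierL2 u + fourierL2 v := map_add _ _ _
  filter_upwards [Lp.coeFn_add (fourierL2 u) (fourierL2 v)] with ξ h
  simp only [symbolMul, h1, h, Pi.add_apply, mul_add]

theorem symbolMul_smul (φ : ℝ → ℂ) (c : ℂ) (u : L2R3) :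
    c • symbolMul φ u =ᵐ[volume] symbolMul φ (c • u) := by
  have h1 : fourierL2 (c • u) = c • fourierL2 u := map_smul _ _ _
  filter_upwards [Lp.coeFn_smul c (fourierL2 u)] with ξ h
  simp only [symbolMul, h1, h, Pi.smul_apply, smul_eq_mul]
  ring

theorem symbolMul_zero (φ : ℝ → ℂ) : 0 =ᵐ[volume] symbolMul φ 0 := by
  have h1 : fourierL2 0 = 0 := map_zero _
  filter_upwards [Lp.coeFn_zero ℂ 2 (volume : Measure R3)] with ξ h
  simp only [symbolMul, h1, h, Pi.zero_apply, mul_zero]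

/-- All `u` in `L²(ℝ³)` such that `φ(|k|)` times the Fourier transform of `u` is in `L²(ℝ³)`. -/
def freeFunctionDomain (φ : ℝ → ℂ) : Submodule ℂ L2R3 where
  carrier := {u | MemLp (symbolMul φ u) 2 volume}
  add_mem' := fun {u v} hu hv => (MemLp.add hu hv).ae_eq (symbolMul_add φ u v)
  zero_mem' := (MemLp.zero (p := 2) (μ := (volume : Measure R3)) (ε := ℂ)).ae_eq (symbolMul_zero φ)
  smul_mem' := fun c u hu => (MemLp.const_smul hu c).ae_eq (symbolMul_smul φ c u)

theorem memLp_symbolMul {φ : ℝ → ℂ} (u : freeFunctionDomain φ) :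
    MemLp (symbolMul φ (u : L2R3)) 2 volume := u.2

/-- Functional calculus of the free operator `H₀ = √(-Δ)` in `L²(ℝ³)`: the operator `φ(H₀)` acts
in the Fourier representation as multiplication by `φ(|k|)`, on its maximal domain. For `φ(l) = l`
this is `H₀` itself, whose domain is the Sobolev space of order one. -/
def freeFunction (φ : ℝ → ℂ) : L2R3 →ₗ.[ℂ] L2R3 where
  domain := freeFunctionDomain φ
  toFun :=
    { toFun := fun u => fourierL2.symm (MemLp.toLp (symbolMul φ u.1) (memLp_symbolMul u))
      map_add' := fun u v => by
        rw [← map_add, ← MemLp.toLp_add (memLp_symbolMul u) (memLp_symbolMul v)]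
        exact congrArg _ (MemLp.toLp_congr _ _ (symbolMul_add φ u.1 v.1).symm)
      map_smul' := fun c u => by
        rw [RingHom.id_apply, ← map_smul, ← MemLp.toLp_const_smul c (memLp_symbolMul u)]
        exact congrArg _ (MemLp.toLp_congr _ _ (symbolMul_smul φ c u.1).symm) }

/-- A bounded continuous function of `H₀` is everywhere defined. -/
theorem mem_freeFunction_domain {φ : ℝ → ℂ} (hφ : Continuous φ) {C : ℝ}
    (hC : ∀ l : ℝ, 0 ≤ l → ‖φ l‖ ≤ C) (u : L2R3) : u ∈ (freeFunction φ).domain := by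
  change MemLp (symbolMul φ u) 2 volume
  refine MemLp.of_le_mul (c := C) (Lp.memLp (fourierL2 u)) ?_ (Eventually.of_forall fun ξ => ?_)
  · exact (hφ.comp (by fun_prop : Continuous fun ξ : R3 => 2 * Real.pi * ‖ξ‖)
      ).aestronglyMeasurable.mul (Lp.aestronglyMeasurable _)
  · rw [symbolMul, norm_mul]
    exact mul_le_mul_of_nonneg_right (hC _ (by positivity)) (norm_nonneg _)

theorem mem_freeFunction_exp_domain {w : ℂ} (hw : 0 ≤ w.re) (u : L2R3) :
    u ∈ (freeFunction fun l : ℝ => exp (-w * l)).domain := by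
  refine mem_freeFunction_domain (by fun_prop) (C := 1) (fun l hl => ?_) u
  rw [norm_exp, Real.exp_le_one_iff]
  simpa using mul_nonneg hw hl

/-- The Poisson semigroup operator `e^{-τH₀}`, for `τ ≥ 0`. -/
def freeSemigroup (τ : ℝ) (hτ : 0 ≤ τ) (u : L2R3) : L2R3 :=
  freeFunction (fun l : ℝ => exp (-(τ : ℂ) * l)) ⟨u, mem_freeFunction_exp_domain (by simpa) u⟩

/-- The free evolution operator `e^{-itH₀}`, for `t` real. -/
def freeEvolution (t : ℝ) (u : L2R3) : L2R3 :=
  freeFunction (fun l : ℝ => exp (-(I * t) * l)) ⟨u, mem_freeFunction_exp_domain (by simp) u⟩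

/-- The class in `L²(ℝ³)` of a Schwartz function. -/
def schwartzL2 (f : 𝓢(R3, ℂ)) : L2R3 := f.toLp 2 volume

/-- The Poisson kernel `w / (π² (r² + w²)²)` of `e^{-wH₀}` as a function of the distance `r`,
for complex `w`. -/
def freeKernel (w : ℂ) (r : ℝ) : ℂ :=
  w / (Real.pi ^ 2 * ((r : ℂ) ^ 2 + w ^ 2) ^ 2)

/-- The iterated integral `∫ { ∫ k(|x - y|) f(y) dy } conj(g(x)) dx`. -/
def kernelPairing (k : ℝ → ℂ) (f g : R3 → ℂ) : ℂ :=
  ∫ x : R3, (∫ y : R3, k ‖x - y‖ * f y) * conj (g x)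

/-- Both integrals in the iterated integral `∫ { ∫ k(|x - y|) f(y) dy } conj(g(x)) dx` converge
absolutely. -/
def KernelPairingConverges (k : ℝ → ℂ) (f g : R3 → ℂ) : Prop :=
  (∀ x : R3, Integrable fun y : R3 => k ‖x - y‖ * f y) ∧
    Integrable fun x : R3 => (∫ y : R3, k ‖x - y‖ * f y) * conj (g x)

end

/-! In momentum space every pairing in question is `∫ e^{-2πw‖ξ‖} 𝓕f conj(𝓕g) dξ`. Since `𝓕 g` has
compact support, this integral is entire in `w`, so the limit as `ε ↘ 0` is continuity at `w = it`;
the singularity of the limiting kernel never has to be analysed. For operators the formula is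
Plancherel (`inner_freeFunction`); for kernels with `Re w > 0` it is Fubini
(`kernelPairing_freeKernel`).

What remains is that `P_w` is the inverse Fourier transform of `e^{-2πw‖ξ‖}`. For real `w` the
exponential is a superposition of Gaussians, whose transforms are explicit; the identity theorem
extends the formula to `Re w > 0` (`integral_exp_neg_mul_norm`). -/

/-! ### Subordination of the exponential to Gaussians -/

section Subordination

theorem image_sub_div_Ioi {c : ℝ} (hc : 0 < c) :
    (fun u : ℝ => u - c / u) '' Set.Ioi 0 = Set.univ := by
  refine Set.eq_univ_of_forall fun v => ?_
  have h1 : 0 ≤ v ^ 2 + 4 * c := by positivity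
  have h2 : |v| < √(v ^ 2 + 4 * c) := by
    rw [← Real.sqrt_sq_eq_abs]
    exact Real.sqrt_lt_sqrt (sq_nonneg v) (by linarith)
  -- The preimage of `v` is the positive root of `u² - v u - c = 0`.
  have h3 : 0 < (v + √(v ^ 2 + 4 * c)) / 2 := by linarith [neg_abs_le v]
  refine ⟨_, h3, ?_⟩
  have h4 := Real.sq_sqrt h1
  generalize √(v ^ 2 + 4 * c) = s at h3 h4
  have h5 : v + s ≠ 0 := by linarith
  field_simp
  linarith

theorem injOn_sub_div_Ioi {c : ℝ} (hc : 0 < c) :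
    Set.InjOn (fun u : ℝ => u - c / u) (Set.Ioi 0) := by
  refine StrictMonoOn.injOn fun a ha b _ hab => ?_
  have := div_lt_div_of_pos_left hc ha hab
  change a - c / a < b - c / b
  linarith

theorem hasDerivWithinAt_sub_div {c u : ℝ} (hu : u ∈ Set.Ioi (0 : ℝ)) :
    HasDerivWithinAt (fun u : ℝ => u - c / u) (1 + c / u ^ 2) (Set.Ioi 0) u := by
  have hu' : u ≠ 0 := ne_of_gt hu
  have := ((hasDerivAt_id u).sub ((hasDerivAt_inv hu').const_mul c)).hasDerivWithinAt
    (s := Set.Ioi 0)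
  convert! this using 1
  ring

theorem hasDerivWithinAt_const_div {c u : ℝ} (hu : u ∈ Set.Ioi (0 : ℝ)) :
    HasDerivWithinAt (fun u : ℝ => c / u) (-(c / u ^ 2)) (Set.Ioi 0) u := by
  have hu' : u ≠ 0 := ne_of_gt hu
  have := ((hasDerivAt_inv hu').const_mul c).hasDerivWithinAt (s := Set.Ioi 0)
  convert! this using 1
  ring

theorem image_const_div_Ioi {c : ℝ} (hc : 0 < c) :
    (fun u : ℝ => c / u) '' Set.Ioi 0 = Set.Ioi 0 := by
  ext v
  constructor
  · rintro ⟨u, hu, rfl⟩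
    exact div_pos hc hu
  · intro hv
    exact ⟨c / v, div_pos hc hv, by field_simp⟩

theorem injOn_const_div_Ioi {c : ℝ} (hc : 0 < c) :
    Set.InjOn (fun u : ℝ => c / u) (Set.Ioi 0) := by
  refine StrictAntiOn.injOn fun a ha b _ hab => ?_
  exact div_lt_div_of_pos_left hc ha hab

/-- The Cauchy–Schlömilch transformation of the Gaussian integral. -/
theorem integral_exp_neg_sub_div_sq {c : ℝ} (hc : 0 ≤ c) :
    ∫ u in Set.Ioi (0 : ℝ), Real.exp (-(u - c / u) ^ 2) = √Real.pi / 2 := by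
  obtain rfl | hc := hc.eq_or_lt
  · simpa using integral_gaussian_Ioi 1
  set F : ℝ → ℝ := fun u => Real.exp (-(u - c / u) ^ 2) with hF
  have habs : ∀ u : ℝ, |1 + c / u ^ 2| = 1 + c / u ^ 2 := fun u => abs_of_pos (by positivity)
  have habs' : ∀ u : ℝ, |-(c / u ^ 2)| = c / u ^ 2 := fun u => by
    rw [abs_neg, abs_of_nonneg (by positivity)]
  have hgauss : Integrable fun v : ℝ => Real.exp (-v ^ 2) := by
    simpa using integrable_exp_neg_mul_sq one_pos
  have hint : IntegrableOn (fun u => (1 + c / u ^ 2) * F u) (Set.Ioi 0) := by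
    have := (integrableOn_image_iff_integrableOn_abs_deriv_smul measurableSet_Ioi
      (fun u hu => hasDerivWithinAt_sub_div hu) (injOn_sub_div_Ioi hc)
      fun v => Real.exp (-v ^ 2)).1 (by rw [image_sub_div_Ioi hc]; exact hgauss.integrableOn)
    simpa only [habs, smul_eq_mul] using this
  have hval : ∫ u in Set.Ioi (0 : ℝ), (1 + c / u ^ 2) * F u = √Real.pi := by
    have := integral_image_eq_integral_abs_deriv_smul measurableSet_Ioi
      (fun u hu => hasDerivWithinAt_sub_div hu) (injOn_sub_div_Ioi hc)
      fun v => Real.exp (-v ^ 2)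
    rw [image_sub_div_Ioi hc, setIntegral_univ] at this
    simp only [habs, smul_eq_mul] at this
    rw [← this]
    simpa using integral_gaussian 1
  have hFint : IntegrableOn F (Set.Ioi 0) := by
    refine Integrable.mono hint (by fun_prop) (Eventually.of_forall fun u => ?_)
    rw [norm_mul]
    refine le_mul_of_one_le_left (norm_nonneg _) ?_
    rw [Real.norm_eq_abs, habs]
    exact le_add_of_nonneg_right (by positivity)
  -- The substitution `u ↦ c / u` preserves `(u - c / u)²`, so the two terms of the weight `1 + c /
  -- u²` contribute equally to `hval`.
  have hsymm : ∫ u in Set.Ioi (0 : ℝ), F u = ∫ u in Set.Ioi (0 : ℝ), c / u ^ 2 * F u := by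
    have := integral_image_eq_integral_abs_deriv_smul measurableSet_Ioi
      (fun u hu => hasDerivWithinAt_const_div hu) (injOn_const_div_Ioi hc) F
    rw [image_const_div_Ioi hc] at this
    rw [this]
    refine setIntegral_congr_fun measurableSet_Ioi fun u hu => ?_
    have hu' : u ≠ 0 := ne_of_gt hu
    simp only [habs', smul_eq_mul, hF]
    congr 3
    field_simp
    ring
  have hdiff : ∫ u in Set.Ioi (0 : ℝ), c / u ^ 2 * F u = √Real.pi - ∫ u in Set.Ioi (0 : ℝ), F u := by
    rw [← hval, ← integral_sub hint hFint]
    congr 1 with u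
    ring
  linarith

/-- The subordination identity for the exponential function. -/
theorem integral_exp_neg_sq_sub_div_sq {c : ℝ} (hc : 0 ≤ c) :
    ∫ u in Set.Ioi (0 : ℝ), Real.exp (-u ^ 2 - (c / u) ^ 2) =
      √Real.pi / 2 * Real.exp (-(2 * c)) := by
  rw [← integral_exp_neg_sub_div_sq hc, ← integral_mul_const]
  refine setIntegral_congr_fun measurableSet_Ioi fun u hu => ?_
  have hu' : u ≠ 0 := ne_of_gt hu
  simp only [← Real.exp_add]
  congr 1
  field_simp
  ring

end Subordination

/-! ### Fourier representation of the Poisson kernel, real parameter -/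

section Poisson

/-- The integrand of the subordination formula for the Poisson kernel. -/
noncomputable def subordinationIntegrand (τ : ℝ) (x : R3) (u : ℝ) (ξ : R3) : ℂ :=
  exp (-(u : ℂ) ^ 2) *
    exp (-((Real.pi * τ / u) ^ 2 : ℝ) * (‖ξ‖ : ℂ) ^ 2 + 2 * Real.pi * I * (inner ℝ x ξ : ℝ))

theorem integral_subordinationIntegrand {τ : ℝ} (hτ : 0 < τ) (x : R3) {u : ℝ} (hu : 0 < u) :
    ∫ ξ, subordinationIntegrand τ x u ξ =
      ((u ^ 3 / (√Real.pi ^ 3 * τ ^ 3) * Real.exp (-((1 + (‖x‖ / τ) ^ 2) * u ^ 2)) : ℝ) : ℂ) := by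
  have hb : 0 < (Real.pi * τ / u) ^ 2 := by have := Real.pi_pos; positivity
  have h := GaussianFourier.integral_cexp_neg_mul_sq_norm_add (V := R3)
    (b := (((Real.pi * τ / u) ^ 2 : ℝ) : ℂ)) (by rw [ofReal_re]; exact hb)
    (2 * Real.pi * I) x
  simp only [subordinationIntegrand]
  rw [integral_const_mul, h]
  -- The base is the square of `u / (√π τ)`, so the power `3 / 2` coming from dimension three is a
  -- cube.
  have h1 : ((Real.pi : ℂ) / (((Real.pi * τ / u) ^ 2 : ℝ) : ℂ)) ^ ((Module.finrank ℝ R3 : ℂ) / 2) =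
      ((u ^ 3 / (√Real.pi ^ 3 * τ ^ 3) : ℝ) : ℂ) := by
    have h2 : Real.pi / (Real.pi * τ / u) ^ 2 = (u / (√Real.pi * τ)) ^ 2 := by
      have := Real.sq_sqrt Real.pi_pos.le
      have h3 : √Real.pi ≠ 0 := (Real.sqrt_pos.2 Real.pi_pos).ne'
      generalize √Real.pi = s at this h3
      rw [← this]
      field_simp
    rw [← ofReal_div, h2]
    have h4 : ((Module.finrank ℝ R3 : ℂ) / 2) = ((3 / 2 : ℝ) : ℂ) := by simp
    rw [h4, ← ofReal_cpow (by positivity), ← Real.rpow_natCast, ← Real.rpow_mul (by positivity)]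
    norm_num
    rw [div_pow, mul_pow]
  rw [h1, mul_left_comm, ← Complex.exp_add, ofReal_mul, ofReal_exp]
  congr 2
  have hu' : (u : ℂ) ≠ 0 := by exact_mod_cast hu.ne'
  have hτ' : (τ : ℂ) ≠ 0 := by exact_mod_cast hτ.ne'
  have hpi : (Real.pi : ℂ) ≠ 0 := by exact_mod_cast Real.pi_ne_zero
  push_cast
  field_simp
  rw [I_sq]
  ring

/-- Only the phase depends on `x`, so absolute integrability reduces to the Gaussian integral at `x
= 0`. -/
theorem norm_subordinationIntegrand (τ : ℝ) (x : R3) (u : ℝ) (ξ : R3) :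
    ((‖subordinationIntegrand τ x u ξ‖ : ℝ) : ℂ) = subordinationIntegrand τ 0 u ξ := by
  rw [subordinationIntegrand, subordinationIntegrand, norm_mul, norm_exp, norm_exp,
    ← Real.exp_add, ← Complex.exp_add, ofReal_exp]
  congr 1
  simp [← ofReal_pow]

theorem measurable_subordinationIntegrand (τ : ℝ) (x : R3) :
    Measurable (Function.uncurry (subordinationIntegrand τ x)) := by
  unfold subordinationIntegrand Function.uncurry
  fun_prop

theorem integrable_subordinationIntegrand {τ : ℝ} (hτ : 0 < τ) (x : R3) {u : ℝ} (hu : 0 < u) :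
    Integrable (subordinationIntegrand τ x u) := by
  have hb : 0 < (Real.pi * τ / u) ^ 2 := by have := Real.pi_pos; positivity
  exact (GaussianFourier.integrable_cexp_neg_mul_sq_norm_add (V := R3)
    (b := (((Real.pi * τ / u) ^ 2 : ℝ) : ℂ)) (by rw [ofReal_re]; exact hb)
    (2 * Real.pi * I) x).const_mul _

theorem integrableOn_cube_mul_exp_neg_mul_sq {b : ℝ} (hb : 0 < b) :
    IntegrableOn (fun u : ℝ => u ^ 3 * Real.exp (-(b * u ^ 2))) (Set.Ioi 0) := by
  simpa using integrableOn_rpow_mul_exp_neg_mul_sq hb (s := 3) (by norm_num)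

theorem integral_cube_mul_exp_neg_mul_sq {b : ℝ} (hb : 0 < b) :
    ∫ u in Set.Ioi (0 : ℝ), u ^ 3 * Real.exp (-(b * u ^ 2)) = 1 / (2 * b ^ 2) := by
  have h := integral_rpow_mul_exp_neg_mul_rpow (p := 2) (q := 3) (b := b) two_pos (by norm_num) hb
  have h1 : (-(3 + 1) / 2 : ℝ) = -(2 : ℕ) := by norm_num
  have h2 : ((3 + 1) / 2 : ℝ) = 1 + 1 := by norm_num
  rw [h1, h2, Real.Gamma_add_one one_ne_zero, Real.Gamma_one, Real.rpow_neg hb.le,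
    Real.rpow_natCast] at h
  norm_num at h
  rw [h]
  field_simp

theorem integrable_prod_subordinationIntegrand {τ : ℝ} (hτ : 0 < τ) (x : R3) :
    Integrable (Function.uncurry (subordinationIntegrand τ x))
      ((volume.restrict (Set.Ioi 0)).prod volume) := by
  rw [integrable_prod_iff (measurable_subordinationIntegrand τ x).aestronglyMeasurable]
  constructor
  · filter_upwards [ae_restrict_mem measurableSet_Ioi] with u hu
    exact integrable_subordinationIntegrand hτ x hu
  · have h := (integrableOn_cube_mul_exp_neg_mul_sq one_pos).const_mul (1 / (√Real.pi ^ 3 * τ ^ 3))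
    refine h.congr ?_
    filter_upwards [ae_restrict_mem measurableSet_Ioi] with u hu
    apply ofReal_injective
    simp only [Function.uncurry]
    rw [← integral_complex_ofReal]
    simp only [norm_subordinationIntegrand]
    rw [integral_subordinationIntegrand hτ 0 hu]
    simp only [norm_zero]
    push_cast
    ring_nf

theorem setIntegral_subordinationIntegrand {τ : ℝ} (hτ : 0 < τ) (x ξ : R3) :
    ∫ u in Set.Ioi (0 : ℝ), subordinationIntegrand τ x u ξ =
      (√Real.pi / 2 : ℝ) * (exp (-(τ : ℂ) * (2 * Real.pi * ‖ξ‖ : ℝ)) *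
        exp (2 * Real.pi * I * (inner ℝ x ξ : ℝ))) := by
  have h := integral_exp_neg_sq_sub_div_sq (c := Real.pi * τ * ‖ξ‖)
    (by have := Real.pi_pos; positivity)
  have h1 : ∀ u : ℝ, subordinationIntegrand τ x u ξ =
      ((Real.exp (-u ^ 2 - (Real.pi * τ * ‖ξ‖ / u) ^ 2) : ℝ) : ℂ) *
        exp (2 * Real.pi * I * (inner ℝ x ξ : ℝ)) := fun u => by
    rw [subordinationIntegrand, Complex.exp_add, ← mul_assoc, ← Complex.exp_add, ofReal_exp]
    congr 2
    push_cast
    ring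
  simp only [h1]
  rw [integral_mul_const, integral_complex_ofReal, h]
  push_cast
  rw [show -(τ : ℂ) * (2 * Real.pi * ‖ξ‖) = -(2 * (Real.pi * τ * ‖ξ‖)) by ring]
  ring

/-- Up to a constant this is a marginal of the integrable two-variable integrand, so no polar
coordinates are needed. -/
theorem integrable_exp_neg_mul_norm {τ : ℝ} (hτ : 0 < τ) :
    Integrable fun ξ : R3 => Real.exp (-(τ * (2 * Real.pi * ‖ξ‖))) := by
  have h := ((integrable_prod_subordinationIntegrand hτ 0).integral_prod_right).norm
  simp only [Function.uncurry, setIntegral_subordinationIntegrand hτ] at h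
  have hpi : √Real.pi ≠ 0 := (Real.sqrt_pos.2 Real.pi_pos).ne'
  refine (h.const_mul (√Real.pi / 2)⁻¹).congr (Eventually.of_forall fun ξ => ?_)
  simp only [inner_zero_left, norm_mul, norm_exp, norm_real, Real.norm_eq_abs,
    abs_of_nonneg (show 0 ≤ √Real.pi / 2 by positivity)]
  simp
  field_simp

/-- The Fourier representation of the Poisson kernel for real parameter. -/
theorem integral_exp_neg_ofReal_mul_norm {τ : ℝ} (hτ : 0 < τ) (x : R3) :
    ∫ ξ : R3, exp (-(τ : ℂ) * (2 * Real.pi * ‖ξ‖ : ℝ)) *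
      exp (2 * Real.pi * I * (inner ℝ x ξ : ℝ)) = freeKernel τ ‖x‖ := by
  have h := integral_integral_swap (integrable_prod_subordinationIntegrand hτ x)
  simp only [setIntegral_subordinationIntegrand hτ] at h
  rw [integral_const_mul, setIntegral_congr_fun measurableSet_Ioi fun u hu =>
    integral_subordinationIntegrand hτ x hu, integral_complex_ofReal] at h
  -- With the `ξ`-integral done first, `∫ u³ e^{-b u²} du = 1 / (2b²)` at this `b` produces the
  -- squared denominator of the kernel.
  have hb : 0 < 1 + (‖x‖ / τ) ^ 2 := by positivity
  have h1 := integral_cube_mul_exp_neg_mul_sq hb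
  have hpi : (√Real.pi : ℂ) ≠ 0 := by exact_mod_cast (Real.sqrt_pos.2 Real.pi_pos).ne'
  have hsq : (√Real.pi : ℂ) ^ 2 = Real.pi := by exact_mod_cast Real.sq_sqrt Real.pi_pos.le
  have hτ' : (τ : ℂ) ≠ 0 := by exact_mod_cast hτ.ne'
  have hd : (τ : ℂ) ^ 2 + (‖x‖ : ℂ) ^ 2 ≠ 0 := by
    exact_mod_cast (show 0 < τ ^ 2 + ‖x‖ ^ 2 by positivity).ne'
  have hd' : (‖x‖ : ℂ) ^ 2 + (τ : ℂ) ^ 2 ≠ 0 := by rwa [add_comm]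
  simp only [div_mul_eq_mul_div, integral_div, h1] at h
  have h2 : (((√Real.pi / 2 : ℝ) : ℂ)) ≠ 0 := by
    push_cast
    exact div_ne_zero hpi two_ne_zero
  rw [← mul_right_inj' h2, ← h, freeKernel, ← hsq]
  push_cast
  field_simp
  ring

end Poisson

/-! ### Holomorphy of Laplace-type integrals -/

section Laplace

/-- A Laplace-type integral is complex differentiable inside its half-plane of absolute
convergence. -/
theorem differentiableAt_integral_exp_neg_mul {α : Type*} [MeasurableSpace α] {μ : Measure α}
    {a : α → ℝ} {h : α → ℂ} (ha : Measurable a) (ha0 : ∀ x, 0 ≤ a x)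
    (hh : AEStronglyMeasurable h μ) {c : ℝ}
    (hint : ∀ s, c < s → Integrable (fun x => Real.exp (-(s * a x)) * ‖h x‖) μ) {w : ℂ}
    (hw : c < w.re) :
    DifferentiableAt ℂ (fun z : ℂ => ∫ x, exp (-z * a x) * h x ∂μ) w := by
  -- One `δ` is the radius of the ball, one absorbs the factor `a x` of the derivative via `a ≤ δ⁻¹
  -- e^{δ a}`, and one keeps `w.re - 2δ` above `c`.
  set δ := (w.re - c) / 3 with hδ
  have hδ0 : 0 < δ := by linarith
  have hmeas : ∀ z : ℂ, AEStronglyMeasurable (fun x => exp (-z * a x) * h x) μ := fun z =>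
    (Measurable.aestronglyMeasurable (by fun_prop)).mul hh
  have hnorm : ∀ (z : ℂ) x, ‖exp (-z * a x) * h x‖ = Real.exp (-(z.re * a x)) * ‖h x‖ := by
    intro z x
    rw [norm_mul, norm_exp]
    simp
  have hderiv := hasDerivAt_integral_of_dominated_loc_of_deriv_le (μ := μ) (𝕜 := ℂ)
    (F := fun (z : ℂ) x => exp (-z * a x) * h x)
    (F' := fun (z : ℂ) x => -(a x : ℂ) * (exp (-z * a x) * h x)) (x₀ := w)
    (bound := fun x => δ⁻¹ * (Real.exp (-((w.re - 2 * δ) * a x)) * ‖h x‖))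
    (Metric.ball_mem_nhds w hδ0) (Eventually.of_forall hmeas)
    (((hint w.re hw)).mono' (hmeas w) (Eventually.of_forall fun x => (hnorm w x).le))
    ((Measurable.aestronglyMeasurable (by fun_prop)).mul (hmeas w))
    (Eventually.of_forall fun x z hz => ?_)
    ((hint _ (by linarith)).const_mul _)
    (Eventually.of_forall fun x z _ => ?_)
  · exact hderiv.2.differentiableAt
  · have hz' : w.re - δ ≤ z.re := by
      have h1 := (abs_re_le_norm (z - w)).trans_lt (mem_ball_iff_norm.1 hz)
      rw [sub_re] at h1
      linarith [(abs_lt.1 h1).1]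
    rw [norm_mul, hnorm, norm_neg, norm_real, Real.norm_of_nonneg (ha0 x), ← mul_assoc,
      ← mul_assoc]
    refine mul_le_mul_of_nonneg_right ?_ (norm_nonneg _)
    have h2 : a x ≤ δ⁻¹ * Real.exp (δ * a x) := by
      rw [le_inv_mul_iff₀ hδ0]
      linarith [Real.add_one_le_exp (δ * a x)]
    calc a x * Real.exp (-(z.re * a x))
        ≤ δ⁻¹ * Real.exp (δ * a x) * Real.exp (-((w.re - δ) * a x)) := by
          refine mul_le_mul h2 (Real.exp_le_exp.2 ?_) (Real.exp_pos _).le (by positivity)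
          exact neg_le_neg (mul_le_mul_of_nonneg_right hz' (ha0 x))
      _ = δ⁻¹ * Real.exp (-((w.re - 2 * δ) * a x)) := by
          rw [mul_assoc, ← Real.exp_add]
          congr 2
          ring
  · have h1 := (((hasDerivAt_id z).neg.mul_const (a x : ℂ)).cexp).mul_const (h x)
    convert! h1 using 1
    simp only [id, Pi.neg_apply]
    ring

end Laplace

/-! ### Continuation to the right half-plane -/

section ComplexParameter

theorem sq_add_sq_ne_zero_of_re_pos {w : ℂ} (hw : 0 < w.re) (r : ℝ) : (r : ℂ) ^ 2 + w ^ 2 ≠ 0 := by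
  intro h
  have h1 : (w - I * r) * (w + I * r) = 0 := by
    linear_combination h - (r : ℂ) ^ 2 * I_sq
  rcases mul_eq_zero.1 h1 with h2 | h2 <;>
  · have h3 := congrArg re h2
    simp at h3
    exact hw.ne' h3

theorem convex_re_pos : Convex ℝ {w : ℂ | 0 < w.re} := convex_halfSpace_re_gt 0

theorem isOpen_re_pos : IsOpen {w : ℂ | 0 < w.re} := isOpen_lt continuous_const continuous_re

theorem differentiableOn_freeKernel (r : ℝ) :
    DifferentiableOn ℂ (fun w => freeKernel w r) {w : ℂ | 0 < w.re} := by
  intro w hw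
  have h := sq_add_sq_ne_zero_of_re_pos hw r
  have hpi : (Real.pi : ℂ) ≠ 0 := by exact_mod_cast Real.pi_ne_zero
  refine DifferentiableAt.differentiableWithinAt ?_
  unfold freeKernel
  exact differentiableAt_id.div (by fun_prop) (mul_ne_zero (pow_ne_zero 2 hpi) (pow_ne_zero 2 h))

theorem norm_exp_two_pi_inner (x ξ : R3) : ‖exp (2 * Real.pi * I * (inner ℝ x ξ : ℝ))‖ = 1 := by
  rw [norm_exp]; simp

/-- The Fourier representation of the Poisson kernel for complex parameter. -/
theorem integral_exp_neg_mul_norm {w : ℂ} (hw : 0 < w.re) (x : R3) :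
    ∫ ξ : R3, exp (-w * (2 * Real.pi * ‖ξ‖ : ℝ)) * exp (2 * Real.pi * I * (inner ℝ x ξ : ℝ)) =
      freeKernel w ‖x‖ := by
  have h1 : DifferentiableOn ℂ (fun w : ℂ => ∫ ξ : R3, exp (-w * (2 * Real.pi * ‖ξ‖ : ℝ)) *
      exp (2 * Real.pi * I * (inner ℝ x ξ : ℝ))) {w : ℂ | 0 < w.re} := fun z hz => by
    refine (differentiableAt_integral_exp_neg_mul (c := 0) (by fun_prop) (fun ξ => by positivity)
      (Continuous.aestronglyMeasurable (by fun_prop)) (fun s hs => ?_) hz).differentiableWithinAt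
    simpa only [norm_exp_two_pi_inner, mul_one] using integrable_exp_neg_mul_norm hs
  -- Identity theorem: both sides agree at real points accumulating at `1`.
  refine (h1.analyticOnNhd isOpen_re_pos).eqOn_of_preconnected_of_frequently_eq
    ((differentiableOn_freeKernel ‖x‖).analyticOnNhd isOpen_re_pos) convex_re_pos.isPreconnected
    (z₀ := ((1 : ℝ) : ℂ)) (by simp) ?_ hw
  have htend : Tendsto (fun τ : ℝ => (τ : ℂ)) (𝓝[≠] 1) (𝓝[≠] ((1 : ℝ) : ℂ)) :=
    tendsto_nhdsWithin_of_tendsto_nhds_of_eventually_within _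
      (continuous_ofReal.continuousAt.mono_left nhdsWithin_le_nhds)
      (eventually_nhdsWithin_of_forall fun τ hτ => by simpa using hτ)
  refine htend.frequently (Eventually.frequently ?_)
  filter_upwards [nhdsWithin_le_nhds (lt_mem_nhds one_pos)] with τ hτ
  exact integral_exp_neg_ofReal_mul_norm hτ x

theorem integrable_cexp_neg_mul_norm {w : ℂ} (hw : 0 < w.re) :
    Integrable fun ξ : R3 => exp (-w * (2 * Real.pi * ‖ξ‖ : ℝ)) := by
  refine (integrable_exp_neg_mul_norm hw).mono' (Continuous.aestronglyMeasurable (by fun_prop))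
    (Eventually.of_forall fun ξ => ?_)
  rw [norm_exp]
  simp

/-- The bound is uniform in `x`, so both iterated integrals converge for merely integrable `f` and
`g`. -/
theorem norm_freeKernel_le {w : ℂ} (hw : 0 < w.re) (x : R3) :
    ‖freeKernel w ‖x‖‖ ≤ ∫ ξ : R3, ‖exp (-w * (2 * Real.pi * ‖ξ‖ : ℝ))‖ := by
  rw [← integral_exp_neg_mul_norm hw]
  refine (norm_integral_le_integral_norm _).trans_eq ?_
  simp only [norm_mul, norm_exp_two_pi_inner, mul_one]

theorem measurable_freeKernel (w : ℂ) : Measurable (freeKernel w) := by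
  unfold freeKernel
  fun_prop

theorem kernelPairingConverges_freeKernel {w : ℂ} (hw : 0 < w.re) {f g : R3 → ℂ}
    (hf : Integrable f) (hg : Integrable g) : KernelPairingConverges (freeKernel w) f g := by
  have hk := measurable_freeKernel w
  constructor
  · intro x
    exact hf.bdd_mul (Measurable.aestronglyMeasurable (by fun_prop))
      (Eventually.of_forall fun y => norm_freeKernel_le hw (x - y))
  · have hg' : Integrable fun x => conj (g x) := hg.congr'
      (continuous_conj.comp_aestronglyMeasurable hg.1) (Eventually.of_forall fun x => by simp)
    have h := (hg'.mul_prod hf).bdd_mul (f := fun p : R3 × R3 => freeKernel w ‖p.1 - p.2‖)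
      (Measurable.aestronglyMeasurable (by fun_prop))
      (Eventually.of_forall fun p => norm_freeKernel_le hw (p.1 - p.2))
    refine h.integral_prod_left.congr (Eventually.of_forall fun x => ?_)
    simp only
    rw [← integral_mul_const]
    congr 1 with y
    ring

end ComplexParameter

/-! ### Pairings in momentum space and boundary values -/

section Pairing

theorem fourier_apply_eq_integral (f : R3 → ℂ) (ξ : R3) :
    𝓕 f ξ = ∫ y, exp (-(2 * Real.pi * I * (inner ℝ y ξ : ℝ))) * f y := by
  rw [Real.fourier_eq']
  congr 1 with y
  rw [smul_eq_mul]
  congr 2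
  push_cast
  ring

theorem conj_fourier_apply_eq_integral (g : R3 → ℂ) (ξ : R3) :
    conj (𝓕 g ξ) = ∫ x, exp (2 * Real.pi * I * (inner ℝ x ξ : ℝ)) * conj (g x) := by
  rw [fourier_apply_eq_integral, ← integral_conj]
  congr 1 with x
  rw [map_mul, ← exp_conj]
  simp [map_ofNat]

theorem integral_freeKernel_mul {w : ℂ} (hw : 0 < w.re) {f : R3 → ℂ} (hf : Integrable f) (x : R3) :
    ∫ y, freeKernel w ‖x - y‖ * f y =
      ∫ ξ : R3, exp (2 * Real.pi * I * (inner ℝ x ξ : ℝ)) *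
        (exp (-w * (2 * Real.pi * ‖ξ‖ : ℝ)) * 𝓕 f ξ) := by
  have hswap := integral_integral_swap (μ := (volume : Measure R3)) (ν := (volume : Measure R3))
    (f := fun y ξ => exp (2 * Real.pi * I * (inner ℝ (x - y) ξ : ℝ)) *
      (f y * exp (-w * (2 * Real.pi * ‖ξ‖ : ℝ))))
    ((hf.mul_prod (integrable_cexp_neg_mul_norm hw)).bdd_mul (c := 1)
      (f := fun p : R3 × R3 => exp (2 * Real.pi * I * (inner ℝ (x - p.1) p.2 : ℝ)))
      (Continuous.aestronglyMeasurable (by fun_prop))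
      (Eventually.of_forall fun p => (norm_exp_two_pi_inner _ _).le))
  calc ∫ y, freeKernel w ‖x - y‖ * f y
      = ∫ y, ∫ ξ : R3, exp (2 * Real.pi * I * (inner ℝ (x - y) ξ : ℝ)) *
          (f y * exp (-w * (2 * Real.pi * ‖ξ‖ : ℝ))) := by
        congr 1 with y
        rw [← integral_exp_neg_mul_norm hw, ← integral_mul_const]
        congr 1 with ξ
        ring
    _ = _ := by
        rw [hswap]
        congr 1 with ξ
        rw [fourier_apply_eq_integral, ← integral_const_mul, ← integral_const_mul]
        congr 1 with y
        rw [inner_sub_left, ofReal_sub, mul_sub, sub_eq_add_neg, Complex.exp_add]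
        ring

theorem kernelPairing_freeKernel {w : ℂ} (hw : 0 < w.re) (f g : 𝓢(R3, ℂ)) :
    kernelPairing (freeKernel w) f g =
      ∫ ξ : R3, exp (-w * (2 * Real.pi * ‖ξ‖ : ℝ)) *
        ((𝓕 f : 𝓢(R3, ℂ)) ξ * conj ((𝓕 g : 𝓢(R3, ℂ)) ξ)) := by
  have hg' : Integrable fun x => conj (g x) := g.integrable.congr'
    (continuous_conj.comp_aestronglyMeasurable g.integrable.1) (Eventually.of_forall fun x => by simp)
  have hmf : Integrable fun ξ : R3 => exp (-w * (2 * Real.pi * ‖ξ‖ : ℝ)) * (𝓕 f : 𝓢(R3, ℂ)) ξ :=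
    (𝓕 f : 𝓢(R3, ℂ)).integrable.bdd_mul (c := 1) (Continuous.aestronglyMeasurable (by fun_prop))
      (Eventually.of_forall fun ξ => by
        rw [norm_exp, Real.exp_le_one_iff]
        simp
        positivity)
  have hswap := integral_integral_swap (μ := (volume : Measure R3)) (ν := (volume : Measure R3))
    (f := fun x ξ => exp (2 * Real.pi * I * (inner ℝ x ξ : ℝ)) *
      (conj (g x) * (exp (-w * (2 * Real.pi * ‖ξ‖ : ℝ)) * (𝓕 f : 𝓢(R3, ℂ)) ξ)))
    ((hg'.mul_prod hmf).bdd_mul (c := 1)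
      (f := fun p : R3 × R3 => exp (2 * Real.pi * I * (inner ℝ p.1 p.2 : ℝ)))
      (Continuous.aestronglyMeasurable (by fun_prop))
      (Eventually.of_forall fun p => (norm_exp_two_pi_inner _ _).le))
  calc kernelPairing (freeKernel w) f g
      = ∫ x, ∫ ξ : R3, exp (2 * Real.pi * I * (inner ℝ x ξ : ℝ)) *
      (conj (g x) * (exp (-w * (2 * Real.pi * ‖ξ‖ : ℝ)) * (𝓕 f : 𝓢(R3, ℂ)) ξ)) := by
        unfold kernelPairing
        congr 1 with x
        rw [integral_freeKernel_mul hw f.integrable, ← integral_mul_const]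
        congr 1 with ξ
        rw [SchwartzMap.fourier_coe]
        ring
    _ = _ := by
        rw [hswap]
        congr 1 with ξ
        rw [SchwartzMap.fourier_coe g, conj_fourier_apply_eq_integral, ← mul_assoc,
          ← integral_const_mul]
        congr 1 with x
        ring

theorem fourierL2_schwartzL2 (f : 𝓢(R3, ℂ)) : fourierL2 (schwartzL2 f) = schwartzL2 (𝓕 f) :=
  SchwartzMap.toLp_fourier_eq f

/-- Plancherel. The inner product is conjugate-linear in its first slot, hence `g` stands first. -/
theorem inner_freeFunction (φ : ℝ → ℂ) (f g : 𝓢(R3, ℂ))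
    (h : schwartzL2 f ∈ (freeFunction φ).domain) :
    inner ℂ (schwartzL2 g) (freeFunction φ ⟨schwartzL2 f, h⟩) =
      ∫ ξ : R3, φ (2 * Real.pi * ‖ξ‖) *
        ((𝓕 f : 𝓢(R3, ℂ)) ξ * conj ((𝓕 g : 𝓢(R3, ℂ)) ξ)) := by
  change inner ℂ (schwartzL2 g) (fourierL2.symm (MemLp.toLp (symbolMul φ (schwartzL2 f)) _)) = _
  rw [← LinearIsometryEquiv.inner_map_map fourierL2, LinearIsometryEquiv.apply_symm_apply,
    L2.inner_def]
  refine integral_congr_ae ?_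
  filter_upwards [MemLp.coeFn_toLp (memLp_symbolMul ⟨schwartzL2 f, h⟩),
    (𝓕 f : 𝓢(R3, ℂ)).coeFn_toLp 2, (𝓕 g : 𝓢(R3, ℂ)).coeFn_toLp 2] with ξ h1 h2 h3
  rw [h1, symbolMul, fourierL2_schwartzL2, fourierL2_schwartzL2, schwartzL2, schwartzL2, h2, h3,
    RCLike.inner_apply]
  ring

/-- For compactly supported momentum distribution the pairing extends to an entire function. -/
theorem differentiable_integral_exp_neg_mul_norm (f g : 𝓢(R3, ℂ))
    (hg : HasCompactSupport (𝓕 g : 𝓢(R3, ℂ))) :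
    Differentiable ℂ fun w : ℂ => ∫ ξ : R3, exp (-w * (2 * Real.pi * ‖ξ‖ : ℝ)) *
        ((𝓕 f : 𝓢(R3, ℂ)) ξ * conj ((𝓕 g : 𝓢(R3, ℂ)) ξ)) := by
  intro w
  -- Compact support gives integrability for every `s`, so any `c < w.re` would do.
  refine differentiableAt_integral_exp_neg_mul (c := w.re - 1) (by fun_prop)
    (fun ξ => by positivity) (Continuous.aestronglyMeasurable (by fun_prop)) (fun s _ => ?_)
    (by linarith)
  refine Continuous.integrable_of_hasCompactSupport (by fun_prop) (hg.mono fun ξ hξ => ?_)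
  contrapose! hξ
  simp only [Function.mem_support, not_not] at hξ ⊢
  simp [hξ]

/-- A difference of squares, as `it + ε = i(t - iε)`. The denominators agree identically, so their
zeros need no separate case. -/
theorem freeKernel_boundary (t ε r : ℝ) : freeKernel (I * t + ε) r =
    (I * t + ε) / (Real.pi ^ 2 * (r + t - I * ε) ^ 2 * (r - t + I * ε) ^ 2) := by
  have h : (r : ℂ) ^ 2 + (I * t + ε) ^ 2 = (r + t - I * ε) * (r - t + I * ε) := by
    linear_combination ((t : ℂ) ^ 2 + (ε : ℂ) ^ 2) * I_sq
  rw [freeKernel, h, mul_pow, mul_assoc]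

theorem tendsto_kernelPairing_freeKernel (t : ℝ) (f g : 𝓢(R3, ℂ))
    (hg : HasCompactSupport (𝓕 g : 𝓢(R3, ℂ))) :
    Tendsto (fun ε : ℝ => kernelPairing (freeKernel (I * t + ε)) f g) (𝓝[>] 0)
      (𝓝 (inner ℂ (schwartzL2 g) (freeEvolution t (schwartzL2 f)))) := by
  rw [freeEvolution, inner_freeFunction]
  have h := ((differentiable_integral_exp_neg_mul_norm f g hg).continuous.comp
    (by fun_prop : Continuous fun ε : ℝ => I * t + (ε : ℂ))).tendsto 0
  simp only [Function.comp_def, ofReal_zero, add_zero] at h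
  refine (h.mono_left nhdsWithin_le_nhds).congr' ?_
  -- The kernel formula is used only for `ε > 0`, where `Re w > 0`.
  filter_upwards [self_mem_nhdsWithin] with ε hε
  exact (kernelPairing_freeKernel (by simpa using hε) f g).symm

end Pairing

/-! ### The free evolution formula -/

theorem mainTheorem12 (f : R3 → ℂ) (hf : ContDiff ℝ ∞ f) (hfc : HasCompactSupport f)
    (g : 𝓢(R3, ℂ)) (hg : HasCompactSupport (𝓕 g : 𝓢(R3, ℂ))) :
    -- convergence of the integrals against the Poisson kernel of complex parameter
    (∀ w : ℂ, 0 < w.re → KernelPairingConverges (freeKernel w) f g) ∧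
    -- the Poisson kernel is the kernel of the semigroup
    (∀ (τ : ℝ) (hτ : 0 < τ),
      inner ℂ (schwartzL2 g) (freeSemigroup τ hτ.le (schwartzL2 (hfc.toSchwartzMap hf))) =
        kernelPairing (freeKernel τ) f g) ∧
    -- its analytic continuation to the right half-plane
    DifferentiableOn ℂ (fun w : ℂ => kernelPairing (freeKernel w) f g) {w : ℂ | 0 < w.re} ∧
    -- on the half-plane, `w = it + ε` gives the regularized evolution kernel
    (∀ t ε r : ℝ, freeKernel (I * t + ε) r =
      (I * t + ε) / (Real.pi ^ 2 * (r + t - I * ε) ^ 2 * (r - t + I * ε) ^ 2)) ∧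
    -- boundary values, `t > 0`
    (∀ t : ℝ, 0 < t → Tendsto
      (fun ε : ℝ => kernelPairing (fun r : ℝ =>
        (I * t + ε) / (Real.pi ^ 2 * (r + t - I * ε) ^ 2 * (r - t + I * ε) ^ 2)) f g)
      (𝓝[>] 0)
      (𝓝 (inner ℂ (schwartzL2 g) (freeEvolution t (schwartzL2 (hfc.toSchwartzMap hf)))))) ∧
    -- boundary values, `t < 0`
    (∀ t : ℝ, t < 0 → Tendsto
      (fun ε : ℝ => kernelPairing (fun r : ℝ =>
        (I * t + ε) / (Real.pi ^ 2 * (r - t + I * ε) ^ 2 * (r + t - I * ε) ^ 2)) f g)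
      (𝓝[>] 0)
      (𝓝 (inner ℂ (schwartzL2 g) (freeEvolution t (schwartzL2 (hfc.toSchwartzMap hf)))))) := by
  have hcoe : ⇑(hfc.toSchwartzMap hf) = f := rfl
  refine ⟨fun w hw => kernelPairingConverges_freeKernel hw ?_ g.integrable, fun τ hτ => ?_, ?_,
    freeKernel_boundary, fun t _ => ?_, fun t _ => ?_⟩
  · exact (hfc.toSchwartzMap hf).integrable
  · rw [freeSemigroup, inner_freeFunction]
    exact (kernelPairing_freeKernel (by simpa using hτ) (hfc.toSchwartzMap hf) g).symm
  · refine (differentiable_integral_exp_neg_mul_norm (hfc.toSchwartzMap hf) g hg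
      ).differentiableOn.congr fun w hw => ?_
    exact kernelPairing_freeKernel hw (hfc.toSchwartzMap hf) g
  · refine (tendsto_kernelPairing_freeKernel t (hfc.toSchwartzMap hf) g hg).congr fun ε => ?_
    rw [hcoe]
    congr 1 with r
    rw [freeKernel_boundary]
  -- The lower signs merely exchange the two factors of the denominator.
  · refine (tendsto_kernelPairing_freeKernel t (hfc.toSchwartzMap hf) g hg).congr fun ε => ?_
    rw [hcoe]
    congr 1 with r
    rw [freeKernel_boundary]
    ring
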